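/- A scheme is \emph{Cohen--Macaulay} if it is locally Noetherian and each of its local rings has depth equal to its Krull dimension. A scheme $X$ is \emph{CM-quasi-excellent} if it is locally Noetherian and (1) for every $x \in X$, all the fibers of the map $\operatorname{Spec}(\widehat{\mathcal{O}}_{X,x}) \to \operatorname{Spec}(\mathcal{O}_{X,x})$ are Cohen--Macaulay, where $\widehat{\mathcal{O}}_{X,x}$ is the completion of $\mathcal{O}_{X,x}$ with respect to its maximal ideal; (2) every integral closed subscheme $X' \subset X$ has a nonempty open subscheme that is Cohen--Macaulay. Let $X$ be a locally Noetherian scheme. Suppose that for every integral closed subscheme $X' \subset X$ there are a Cohen--Macaulay scheme $\widetilde{X'}$ and a proper map $\pi\colon \widetilde{X'} \to X'$ that is an isomorphism over a nonempty open subscheme $U \subset X'$ (that is, $\pi^{-1}(U) \to U$ is an isomorphism). Then $X$ is CM-quasi-excellent. -/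

import Mathlib

open CategoryTheory AlgebraicGeometry

universe u

/-- The depth of a local ring `R`: the supremum of the lengths of `R`-regular sequences
contained in the maximal ideal. -/
noncomputable def localDepth (R : Type u) [CommRing R] [IsLocalRing R] : ℕ∞ :=
  ⨆ (rs : List R) (_ : (∀ r ∈ rs, r ∈ IsLocalRing.maximalIdeal R) ∧
    RingTheory.Sequence.IsRegular R rs), (rs.length : ℕ∞)

/-- A scheme is Cohen-Macaulay if it is locally Noetherian and each of its local rings has
depth equal to its Krull dimension. -/
structure IsCohenMacaulayScheme (X : Scheme.{u}) : Prop where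
  isLocallyNoetherian : IsLocallyNoetherian X
  depth_eq_dim : ∀ x : X,
    (localDepth (X.presheaf.stalk x) : WithBot ℕ∞) = ringKrullDim (X.presheaf.stalk x)

/-- The canonical morphism from the spectrum of the completion of a local ring `R` (with respect
to its maximal ideal) to the spectrum of `R`. -/
noncomputable def completionSpecMap (R : Type u) [CommRing R] [IsLocalRing R] :
    Spec (CommRingCat.of (AdicCompletion (IsLocalRing.maximalIdeal R) R)) ⟶
      Spec (CommRingCat.of R) :=
  Spec.map (CommRingCat.ofHom
    (algebraMap R (AdicCompletion (IsLocalRing.maximalIdeal R) R)))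

/-- A scheme `X` is CM-quasi-excellent if it is locally Noetherian, the formal fibers of its local
rings are Cohen-Macaulay, and every integral closed subscheme of `X` has a nonempty
Cohen-Macaulay open subscheme. -/
structure IsCMQuasiExcellent (X : Scheme.{u}) : Prop where
  isLocallyNoetherian : IsLocallyNoetherian X
  formalFiber_cohenMacaulay : ∀ (x : X) (p : Spec (CommRingCat.of (X.presheaf.stalk x))),
    IsCohenMacaulayScheme ((completionSpecMap (X.presheaf.stalk x)).fiber p)
  exists_open_cohenMacaulay : ∀ (Z : Scheme.{u}) (i : Z ⟶ X) [IsClosedImmersion i] [IsIntegral Z],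
    ∃ U : Z.Opens, (U : Set Z).Nonempty ∧ IsCohenMacaulayScheme U.toScheme

section
open IsLocalRing RingTheory.Sequence Pointwise

theorem exists_mem_associatedPrimes_quotSMulTop {A M : Type*} [CommRing A] [IsNoetherianRing A]
    [AddCommGroup M] [Module A M] [Module.Finite A M] [IsLocalRing A] {x : A}
    (hx : x ∈ maximalIdeal A) (hreg : IsSMulRegular M x) {P : Ideal A}
    (hP : P ∈ associatedPrimes A M) :
    ∃ Q ∈ associatedPrimes A (QuotSMulTop x M), P ≤ Q ∧ x ∈ Q := by
  let N : Submodule A M := Submodule.torsionBySet A M P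
  have hN : N ≠ ⊥ := by
    obtain ⟨hprime, m, hm⟩ := (isAssociatedPrime_iff (R := A)).mp hP
    intro h0
    have hmN : m ∈ N := by
      refine (Submodule.mem_torsionBySet_iff _ _).mpr fun a ↦ ?_
      have ha := a.2
      simp only [hm] at ha
      simpa [Submodule.mem_colon_singleton] using ha
    have : m = 0 := by simpa [h0] using hmN
    subst this
    exact hprime.ne_top (by simpa [Submodule.colon_singleton_zero] using hm)
  obtain ⟨n, hn, hnx⟩ : ∃ n ∈ N, n ∉ (x • ⊤ : Submodule A M) := by
    by_contra! H
    refine hN (Submodule.eq_bot_of_le_smul_of_le_jacobson_bot (Ideal.span {x}) N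
      (IsNoetherian.noetherian N) ?_ ?_)
    · intro n hn
      obtain ⟨m, -, rfl⟩ := (Submodule.mem_smul_pointwise_iff_exists _ _ _).mp (H n hn)
      refine Submodule.smul_mem_smul (Ideal.mem_span_singleton_self x) ?_
      refine (Submodule.mem_torsionBySet_iff _ _).mpr fun a ↦ hreg ?_
      have := (Submodule.mem_torsionBySet_iff _ _).mp hn a
      simp only [smul_zero]
      rw [← this, smul_comm]
    · rw [Ideal.span_singleton_le_iff_mem]
      exact maximalIdeal_le_jacobson _ hx
  obtain ⟨Q, hQ, hle⟩ := exists_le_isAssociatedPrime_of_isNoetherianRing A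
    (Submodule.Quotient.mk n : QuotSMulTop x M) (by simpa using hnx)
  refine ⟨Q, hQ, fun a ha ↦ hle ?_, hle ?_⟩
  · have := (Submodule.mem_torsionBySet_iff _ _).mp hn ⟨a, ha⟩
    rw [Submodule.mem_colon_singleton, ← Submodule.Quotient.mk_smul]
    simp_all
  · rw [Submodule.mem_colon_singleton, ← Submodule.Quotient.mk_smul, Submodule.mem_bot,
      Submodule.Quotient.mk_eq_zero]
    exact Submodule.smul_mem_pointwise_smul _ _ _ trivial

theorem ringKrullDim_quotient_add_one_le {A : Type*} [CommRing A] {P Q : Ideal A} [P.IsPrime]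
    (h : P ≤ Q) {x : A} (hxQ : x ∈ Q) (hxP : x ∉ P) :
    ringKrullDim (A ⧸ Q) + 1 ≤ ringKrullDim (A ⧸ P) := by
  refine ringKrullDim_succ_le_of_surjective (Ideal.Quotient.factor h)
    (Ideal.Quotient.factor_surjective h) (r := Ideal.Quotient.mk P x) ?_ ?_
  · exact mem_nonZeroDivisors_of_ne_zero (by simpa [Ideal.Quotient.eq_zero_iff_mem])
  · simpa [Ideal.Quotient.eq_zero_iff_mem]

theorem length_le_ringKrullDim_quotient_of_mem_associatedPrimes {A M : Type*} [CommRing A]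
    [IsNoetherianRing A] [IsLocalRing A] [AddCommGroup M] [Module A M] [Module.Finite A M]
    {rs : List A} (hmem : ∀ r ∈ rs, r ∈ maximalIdeal A) (hreg : IsRegular M rs) {P : Ideal A}
    (hP : P ∈ associatedPrimes A M) :
    (rs.length : WithBot ℕ∞) ≤ ringKrullDim (A ⧸ P) := by
  induction rs generalizing M P with
  | nil =>
    have := hP.isPrime
    simpa using ringKrullDim_nonneg_of_nontrivial
  | cons x rs ih =>
    have hx : x ∈ maximalIdeal A := hmem x (by simp)
    rw [isRegular_cons_iff] at hreg
    have := hP.isPrime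
    obtain ⟨Q, hQ, hPQ, hxQ⟩ := exists_mem_associatedPrimes_quotSMulTop hx hreg.1 hP
    have hxP : x ∉ P := by
      intro h
      have : x ∈ ⋃ p ∈ associatedPrimes A M, (p : Set A) := Set.mem_biUnion hP h
      rw [biUnion_associatedPrimes_eq_compl_regular] at this
      exact this hreg.1
    have h1 := ih (fun r hr ↦ hmem r (by simp [hr])) hreg.2 hQ
    have h2 := ringKrullDim_quotient_add_one_le hPQ hxQ hxP
    push_cast [List.length_cons]
    exact (add_le_add_left h1 1).trans h2

theorem smul_top_lt_top_of_le_maximalIdeal {A M : Type*} [CommRing A] [IsLocalRing A]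
    [AddCommGroup M] [Module A M] [Module.Finite A M] [Nontrivial M] {I : Ideal A}
    (hI : I ≤ maximalIdeal A) : I • (⊤ : Submodule A M) < ⊤ :=
  (Submodule.top_ne_ideal_smul_of_le_jacobson_annihilator
    (hI.trans (maximalIdeal_le_jacobson _))).symm.lt_top

/-- Dividing out a regular element lowers the depth by at most one. -/
theorem exists_isRegular_quotSMulTop {A : Type u} [CommRing A] [IsNoetherianRing A] [IsLocalRing A]
    (M : Type u) [AddCommGroup M] [Module A M] [Module.Finite A M] [Nontrivial M]
    {x : A} (hx : x ∈ maximalIdeal A) (hreg : IsSMulRegular M x) {n : ℕ}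
    (h : ∃ rs : List A, rs.length = n + 1 ∧ (∀ r ∈ rs, r ∈ maximalIdeal A) ∧ IsRegular M rs) :
    ∃ rs : List A, rs.length = n ∧ (∀ r ∈ rs, r ∈ maximalIdeal A) ∧
      IsRegular (QuotSMulTop x M) rs := by
  have := nontrivial_quotSMulTop_of_mem_maximalIdeal M hx
  have h1 := ((ModuleCat.exists_isRegular_tfae (maximalIdeal A) (n + 1) (ModuleCat.of A M)
    (smul_top_lt_top_of_le_maximalIdeal le_rfl)).out 3 1).mp h
  refine ((ModuleCat.exists_isRegular_tfae (maximalIdeal A) n (ModuleCat.of A (QuotSMulTop x M))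
    (smul_top_lt_top_of_le_maximalIdeal le_rfl)).out 1 3).mp fun i hi ↦ ?_
  have zero1 := AddCommGrpCat.isZero_of_iff_subsingleton.mpr (h1 i (by omega))
  have zero2 := AddCommGrpCat.isZero_of_iff_subsingleton.mpr (h1 (i + 1) (by omega))
  exact AddCommGrpCat.subsingleton_of_isZero <| ShortComplex.Exact.isZero_of_both_zeros
    ((Abelian.Ext.covariant_sequence_exact₃' _ (IsSMulRegular.smulShortComplex_shortExact
      (M := ModuleCat.of A M) hreg)) i (i + 1) rfl)
    (zero1.eq_zero_of_src _) (zero2.eq_zero_of_tgt _)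

/-- The inequality `depth M ≤ grade (p, M) + dim A / p`. -/
theorem exists_isRegular_of_mem_le_length_add {A : Type u} [CommRing A] [IsNoetherianRing A]
    [IsLocalRing A] (M : Type u) [AddCommGroup M] [Module A M] [Module.Finite A M] [Nontrivial M]
    (p : Ideal A) [p.IsPrime] {n : ℕ}
    (h : ∃ rs : List A, rs.length = n ∧ (∀ r ∈ rs, r ∈ maximalIdeal A) ∧ IsRegular M rs) :
    ∃ rs : List A, (∀ r ∈ rs, r ∈ p) ∧ IsRegular M rs ∧
      (n : WithBot ℕ∞) ≤ rs.length + ringKrullDim (A ⧸ p) := by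
  have hp := le_maximalIdeal (Ideal.IsPrime.ne_top ‹p.IsPrime›)
  induction n generalizing M with
  | zero => exact ⟨[], by simp, .nil A M, by simpa using ringKrullDim_nonneg_of_nontrivial⟩
  | succ n ih =>
    by_cases hex : ∃ x ∈ p, IsSMulRegular M x
    · obtain ⟨x, hx, hreg⟩ := hex
      have := nontrivial_quotSMulTop_of_mem_maximalIdeal M (hp hx)
      obtain ⟨rs, hrs, hrsreg, hle⟩ := ih (QuotSMulTop x M)
        (exists_isRegular_quotSMulTop M (hp hx) hreg h)
      refine ⟨x :: rs, by simpa [hx] using hrs, .cons hreg hrsreg, ?_⟩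
      push_cast [List.length_cons]
      rw [add_right_comm]
      exact add_le_add_left hle 1
    · refine ⟨[], by simp, .nil A M, ?_⟩
      push Not at hex
      obtain ⟨Q, hQ, hpQ⟩ : ∃ Q ∈ associatedPrimes A M, p ≤ Q := by
        refine (Ideal.subset_union_prime_finite (associatedPrimes.finite A M) ⊤ ⊤
          fun Q hQ _ _ ↦ hQ.isPrime).mp fun x hx ↦ ?_
        rw [biUnion_associatedPrimes_eq_compl_regular]
        exact hex x hx
      obtain ⟨rs, hlen, hrs, hrsreg⟩ := h
      have := length_le_ringKrullDim_quotient_of_mem_associatedPrimes hrs hrsreg hQ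
      rw [hlen] at this
      simpa using this.trans (ringKrullDim_le_of_surjective (Ideal.Quotient.factor hpQ)
        (Ideal.Quotient.factor_surjective hpQ))

theorem localDepth_le_height (A : Type u) [CommRing A] [IsNoetherianRing A] [IsLocalRing A] :
    localDepth A ≤ (maximalIdeal A).height := by
  refine iSup₂_le fun rs hrs ↦ ?_
  have : Nontrivial (A ⧸ Ideal.ofList rs) := by
    refine Ideal.Quotient.nontrivial_iff.mpr fun h ↦ hrs.2.top_ne_smul ?_
    simp [h]
  rw [← WithBot.coe_le_coe, maximalIdeal_height_eq_ringKrullDim,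
    ← ringKrullDim_add_length_eq_ringKrullDim_of_isRegular rs hrs.2]
  simpa using! add_le_add_left (ringKrullDim_nonneg_of_nontrivial (R := A ⧸ Ideal.ofList rs))
    (rs.length : WithBot ℕ∞)

theorem localDepth_eq_ringKrullDim_iff (A : Type u) [CommRing A] [IsNoetherianRing A]
    [IsLocalRing A] :
    (localDepth A : WithBot ℕ∞) = ringKrullDim A ↔
      ∃ rs : List A, (∀ r ∈ rs, r ∈ maximalIdeal A) ∧ IsRegular A rs ∧
        (maximalIdeal A).height ≤ rs.length := by
  rw [← maximalIdeal_height_eq_ringKrullDim, WithBot.coe_inj]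
  refine ⟨fun h ↦ ?_, fun ⟨rs, hrs, hreg, hle⟩ ↦ (localDepth_le_height A).antisymm (hle.trans
    (le_iSup₂_of_le (f := fun (rs : List A) _ ↦ (rs.length : ℕ∞)) rs ⟨hrs, hreg⟩ le_rfl))⟩
  by_contra! H
  obtain ⟨d, hd⟩ := ENat.ne_top_iff_exists.mp (Ideal.height_ne_top (I := maximalIdeal A)
    (Ideal.IsPrime.ne_top inferInstance))
  rw [← hd] at h H
  cases d with
  | zero => simpa using H [] (by simp) (.nil A A)
  | succ d =>
    have : localDepth A ≤ d := iSup₂_le fun rs hrs ↦ by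
      have := H rs hrs.1 hrs.2
      norm_cast at this ⊢
      omega
    rw [h] at this
    norm_cast at this
    omega

theorem Ideal.exists_ringKrullDim_quotient_eq_and_height_add_le {A : Type*} [CommRing A]
    (p : Ideal A) [p.IsPrime] :
    ∃ c : ℕ∞, ringKrullDim (A ⧸ p) = c ∧ ((p.height + c : ℕ∞) : WithBot ℕ∞) ≤ ringKrullDim A := by
  let P : PrimeSpectrum A := ⟨p, inferInstance⟩
  have : Nonempty (PrimeSpectrum A) := ⟨P⟩
  refine ⟨Order.coheight P, ?_, ?_⟩
  · rw [ringKrullDim_quotient, Order.coheight_eq_krullDim_Ici]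
    congr 1
  · rw [ringKrullDim, Order.krullDim_eq_iSup_height_add_coheight_of_nonempty,
      show p.height = Order.height P from P.height_eq_orderHeight]
    exact WithBot.coe_le_coe.mpr (le_iSup (fun a : PrimeSpectrum A ↦
      Order.height a + Order.coheight a) P)

/-- The localization of a Cohen-Macaulay local ring at a prime is Cohen-Macaulay. -/
theorem localDepth_eq_ringKrullDim_of_isLocalization {A B : Type u} [CommRing A]
    [IsNoetherianRing A] [IsLocalRing A] [CommRing B] [IsLocalRing B] [Algebra A B] (p : Ideal A)
    [p.IsPrime] [IsLocalization.AtPrime B p]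
    (h : (localDepth A : WithBot ℕ∞) = ringKrullDim A) :
    (localDepth B : WithBot ℕ∞) = ringKrullDim B := by
  have : IsNoetherianRing B := IsLocalization.isNoetherianRing p.primeCompl B inferInstance
  obtain ⟨rs, hrs, hreg, hle⟩ := (localDepth_eq_ringKrullDim_iff A).mp h
  obtain ⟨ss, hss, hsreg, hsle⟩ := exists_isRegular_of_mem_le_length_add A p ⟨rs, rfl, hrs, hreg⟩
  refine (localDepth_eq_ringKrullDim_iff B).mpr ⟨ss.map (algebraMap A B), ?_,
    hsreg.toIsWeaklyRegular.isRegular_of_isLocalization_of_mem B p hss, ?_⟩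
  · intro r hr
    obtain ⟨s, hs, rfl⟩ := List.mem_map.mp hr
    exact (IsLocalization.AtPrime.to_map_mem_maximal_iff B p s).mpr (hss s hs)
  · obtain ⟨c, hc, h1⟩ := Ideal.exists_ringKrullDim_quotient_eq_and_height_add_le p
    have h2 : (maximalIdeal B).height = p.height := by
      rw [← WithBot.coe_inj, maximalIdeal_height_eq_ringKrullDim,
        IsLocalization.AtPrime.ringKrullDim_eq_height p]
    rw [hc] at hsle
    rw [← maximalIdeal_height_eq_ringKrullDim, WithBot.coe_le_coe] at h1
    rw [h2, List.length_map]
    have h3 : (rs.length : ℕ∞) ≤ ss.length + c := by exact_mod_cast hsle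
    have h4 : p.height + c ≤ rs.length := h1.trans hle
    have hctop : c ≠ ⊤ := fun h ↦ by simp [h] at h4
    exact (ENat.add_le_add_iff_right hctop).mp (h4.trans h3)

/-- Ascent of the Cohen-Macaulay property along a flat local homomorphism with zero-dimensional
closed fiber. -/
theorem localDepth_eq_ringKrullDim_of_flat {A B : Type u} [CommRing A] [IsNoetherianRing A]
    [IsLocalRing A] [CommRing B] [IsLocalRing B] [IsNoetherianRing B] (f : A →+* B) [IsLocalHom f]
    (hf : f.Flat)
    (hfib : ∀ q : PrimeSpectrum B, q.comap f = closedPoint A → q = closedPoint B)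
    (h : (localDepth A : WithBot ℕ∞) = ringKrullDim A) :
    (localDepth B : WithBot ℕ∞) = ringKrullDim B := by
  algebraize [f]
  have : IsLocalHom (algebraMap A B) := ‹_›
  have : Module.FaithfullyFlat A B := .of_flat_of_isLocalHom
  obtain ⟨rs, hrs, hreg, hle⟩ := (localDepth_eq_ringKrullDim_iff A).mp h
  refine (localDepth_eq_ringKrullDim_iff B).mpr ⟨rs.map (algebraMap A B), ?_,
    hreg.of_faithfullyFlat, ?_⟩
  · intro r hr
    obtain ⟨s, hs, rfl⟩ := List.mem_map.mp hr
    exact map_mem_nonunits_iff (algebraMap A B) s |>.mpr (hrs s hs)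
  · obtain ⟨s, hs, hcard⟩ := (maximalIdeal A).exists_finset_card_eq_height_of_isNoetherianRing
    rw [List.length_map]
    refine le_trans ?_ hle
    rw [← hcard]
    classical
    refine (Ideal.height_le_card_of_mem_minimalPrimes_span_finset
      (s := s.image (algebraMap A B)) ?_).trans (by exact_mod_cast Finset.card_image_le)
    rw [Finset.coe_image, ← Ideal.map_span]
    refine ⟨⟨inferInstance, ?_⟩, fun q ⟨hq, hle⟩ hqm ↦ ?_⟩
    · rw [Ideal.map_le_iff_le_comap, maximalIdeal_comap]
      exact hs.1.2
    · have := hfib ⟨q, hq⟩ (PrimeSpectrum.ext ?_)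
      · rw [← show q = maximalIdeal B from congr(($this).asIdeal)]
      · refine le_antisymm (le_maximalIdeal (Ideal.IsPrime.ne_top
          (PrimeSpectrum.isPrime _))) (hs.2 ⟨?_, ?_⟩ ?_)
        · exact PrimeSpectrum.isPrime _
        · exact Ideal.map_le_iff_le_comap.mp hle
        · exact le_maximalIdeal (Ideal.IsPrime.ne_top (PrimeSpectrum.isPrime _))
end

/-- The adic completion of a Noetherian ring is Noetherian. -/
instance AdicCompletion.isNoetherianRing {R : Type*} [CommRing R] [IsNoetherianRing R]
    (I : Ideal R) : IsNoetherianRing (AdicCompletion I R) := by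
  obtain ⟨s, hs⟩ := IsNoetherian.noetherian I
  let J : Ideal (MvPolynomial s R) := MvPolynomial.idealOfVars s R
  have : IsNoetherianRing (AdicCompletion J (MvPolynomial s R)) := isNoetherianRing_of_ringEquiv _
    (MvPowerSeries.toAdicCompletionAlgEquiv s R).toRingEquiv
  let g : MvPolynomial s R →+* R := (MvPolynomial.aeval (fun i : s ↦ (i : R))).toRingHom
  have hJ : J.map g = I := by
    rw [Ideal.map_span, ← Set.range_comp]
    convert! hs
    ext; simp [g]
  have hJn (n : ℕ) : J ^ n ≤ (I ^ n).comap g := by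
    rw [← Ideal.map_le_iff_le_comap, Ideal.map_pow, hJ]
  let f (n : ℕ) : AdicCompletion J (MvPolynomial s R) →+* R ⧸ I ^ n :=
    (Ideal.quotientMap (I ^ n) g (hJn n)).comp (AdicCompletion.evalₐ J n : _ →+* _)
  have hf {m n : ℕ} (hle : m ≤ n) : (Ideal.Quotient.factorPow I hle).comp (f n) = f m := by
    ext x
    obtain ⟨c, rfl⟩ := AdicCompletion.mk_surjective J _ x
    have hc : c m - c n ∈ J ^ m := by simpa [SModEq.sub_mem] using c.2 hle
    simp only [f, RingHom.comp_apply, RingHom.coe_coe, AdicCompletion.evalₐ_mk,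
      Ideal.quotientMap_mk]
    refine (Ideal.Quotient.eq.mpr ?_).symm
    simpa using hJn m hc
  let F := AdicCompletion.liftRingHom I f hf
  have hF (p : MvPolynomial s R) : F (algebraMap (MvPolynomial s R) _ p) = algebraMap R _ (g p) := by
    refine AdicCompletion.ext_evalₐ fun n ↦ ?_
    simp [F, f]
  let K : Ideal (AdicCompletion J (MvPolynomial s R)) := J.map (algebraMap (MvPolynomial s R) _)
  have hK : K.map F = I.map (algebraMap R (AdicCompletion I R)) := by
    have : F.comp (algebraMap (MvPolynomial s R) _) = (algebraMap R _).comp g :=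
      RingHom.ext hF
    rw [Ideal.map_map, this, ← Ideal.map_map, hJ]
  have : IsAdicComplete K (AdicCompletion J (MvPolynomial s R)) :=
    AdicCompletion.isAdicComplete_self _ (MvPolynomial.idealOfVars_fg s R)
  have : IsAdicComplete (K.map F) (AdicCompletion I R) :=
    hK ▸ AdicCompletion.isAdicComplete_self _ (IsNoetherian.noetherian I)
  refine isNoetherianRing_of_surjective _ _ F
    (surjective_of_mk_map_comp_surjective (I := K) F fun y ↦ ?_)
  obtain ⟨y, rfl⟩ := Ideal.Quotient.mk_surjective y
  obtain ⟨r, hr⟩ := Ideal.Quotient.mk_surjective (AdicCompletion.evalOneₐ I y)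
  refine ⟨algebraMap (MvPolynomial s R) _ (MvPolynomial.C r), ?_⟩
  rw [RingHom.comp_apply, hF, Ideal.Quotient.eq, hK,
    ← AdicCompletion.ker_evalOneₐ_eq_map I (IsNoetherian.noetherian I), RingHom.sub_mem_ker_iff]
  simp [g, ← hr]

section
open IsLocalRing Limits

/-- The Cohen-Macaulay property of local rings ascends along a flat morphism at a point which is
the only one of its fiber. -/
theorem localDepth_stalk_eq_of_flat {S T : Scheme.{u}} [IsLocallyNoetherian S]
    [IsLocallyNoetherian T] (f : S ⟶ T) [Flat f] (s : S) (hs : ∀ s', f s' = f s → s' = s)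
    (h : (localDepth (T.presheaf.stalk (f s)) : WithBot ℕ∞) =
      ringKrullDim (T.presheaf.stalk (f s))) :
    (localDepth (S.presheaf.stalk s) : WithBot ℕ∞) = ringKrullDim (S.presheaf.stalk s) := by
  refine localDepth_eq_ringKrullDim_of_flat (f.stalkMap s).hom (Flat.stalkMap f s)
    (fun q hq ↦ ?_) h
  apply (S.fromSpecStalk s).injective
  rw [Scheme.fromSpecStalk_closedPoint]
  apply hs
  have := congr($(Scheme.SpecMap_stalkMap_fromSpecStalk f (x := s)) q)
  have hq' : Spec.map (f.stalkMap s) q = closedPoint (T.presheaf.stalk (f s)) := hq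
  refine Eq.trans ?_ (congr(T.fromSpecStalk (f s) $hq').trans Scheme.fromSpecStalk_closedPoint)
  exact this.symm

theorem IsCohenMacaulayScheme.of_flat_of_injective {S T : Scheme.{u}} [IsLocallyNoetherian S]
    (hT : IsCohenMacaulayScheme T) (f : S ⟶ T) [Flat f] (hf : Function.Injective f) :
    IsCohenMacaulayScheme S where
  isLocallyNoetherian := inferInstance
  depth_eq_dim s :=
    have := hT.isLocallyNoetherian
    localDepth_stalk_eq_of_flat f s (fun _ h ↦ hf h) (hT.depth_eq_dim _)

instance flat_fromSpecStalk (X : Scheme.{u}) (x : X) : Flat (X.fromSpecStalk x) := by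
  obtain ⟨_, ⟨U, hU, rfl⟩, hxU, -⟩ := X.isBasis_affineOpens.exists_subset_of_mem_open
    (Set.mem_univ x) isOpen_univ
  replace hU : IsAffineOpen U := hU
  rw [← IsAffineOpen.fromSpecStalk_eq_fromSpecStalk hU hxU]
  delta IsAffineOpen.fromSpecStalk
  algebraize [(X.presheaf.germ U x hxU).hom]
  have := hU.isLocalization_stalk ⟨x, hxU⟩
  have : Flat (Spec.map (X.presheaf.germ U x hxU)) := Flat.SpecMap_iff.mpr
    (IsLocalization.flat (R := Γ(X, U)) (X.presheaf.stalk x)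
      (hU.primeIdealOf ⟨x, hxU⟩).asIdeal.primeCompl)
  infer_instance

theorem localDepth_eq_ringKrullDim_of_ringEquiv {A B : Type u} [CommRing A] [IsNoetherianRing A]
    [IsLocalRing A] [CommRing B] [IsLocalRing B] (e : A ≃+* B)
    (h : (localDepth A : WithBot ℕ∞) = ringKrullDim A) :
    (localDepth B : WithBot ℕ∞) = ringKrullDim B := by
  have : IsNoetherianRing B := isNoetherianRing_of_ringEquiv A e
  refine localDepth_eq_ringKrullDim_of_flat (e : A →+* B) (.of_bijective e.bijective)
    (fun q hq ↦ ?_) h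
  exact PrimeSpectrum.comap_injective_of_surjective (e : A →+* B) e.surjective
    (hq.trans (comap_closedPoint (e : A →+* B)).symm)

theorem localDepth_stalk_eq_of_specializes {X : Scheme.{u}} [IsLocallyNoetherian X] {x y : X}
    (hxy : y ⤳ x)
    (h : (localDepth (X.presheaf.stalk x) : WithBot ℕ∞) = ringKrullDim (X.presheaf.stalk x)) :
    (localDepth (X.presheaf.stalk y) : WithBot ℕ∞) = ringKrullDim (X.presheaf.stalk y) := by
  obtain ⟨p, rfl⟩ : y ∈ Set.range (X.fromSpecStalk x) := by
    rwa [Scheme.range_fromSpecStalk]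
  let S := (Spec (X.presheaf.stalk x)).presheaf.stalk p
  have : p.asIdeal.IsPrime := PrimeSpectrum.isPrime p
  have hp : (localDepth S : WithBot ℕ∞) = ringKrullDim S :=
    localDepth_eq_ringKrullDim_of_ringEquiv
      (Spec.stalkIso (X.presheaf.stalk x) p).commRingCatIsoToRingEquiv.symm
      (localDepth_eq_ringKrullDim_of_isLocalization (B := Localization.AtPrime p.asIdeal)
        p.asIdeal h)
  have hflat := Flat.stalkMap (X.fromSpecStalk x) p
  have hbij : Function.Bijective ((X.fromSpecStalk x).stalkMap p).hom := by
    refine ⟨?_, (X.fromSpecStalk x).stalkMap_surjective p⟩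
    algebraize [((X.fromSpecStalk x).stalkMap p).hom]
    have : IsLocalHom (algebraMap (X.presheaf.stalk (X.fromSpecStalk x p)) S) :=
      inferInstanceAs (IsLocalHom ((X.fromSpecStalk x).stalkMap p).hom)
    have : Module.FaithfullyFlat (X.presheaf.stalk (X.fromSpecStalk x p)) S :=
      .of_flat_of_isLocalHom
    exact FaithfulSMul.algebraMap_injective (X.presheaf.stalk (X.fromSpecStalk x p)) S
  exact localDepth_eq_ringKrullDim_of_ringEquiv (RingEquiv.ofBijective _ hbij).symm hp

theorem IsCohenMacaulayScheme.opens_of_isIso_restrict {Y Z : Scheme.{u}} [IsLocallyNoetherian Z]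
    (hY : IsCohenMacaulayScheme Y) (f : Y ⟶ Z) (U : Z.Opens) [IsIso (f ∣_ U)] :
    IsCohenMacaulayScheme U.toScheme :=
  hY.of_flat_of_injective (inv (f ∣_ U) ≫ (f ⁻¹ᵁ U).ι) (Scheme.Hom.injective _)

end

section
open Limits IsLocalRing

theorem IsPullback.comp_mono {C : Type*} [Category C] {P X Y Z W : C} {fst : P ⟶ X} {snd : P ⟶ Y}
    {f : X ⟶ Z} {g : Y ⟶ Z} (h : IsPullback fst snd f g) (i : Z ⟶ W) [Mono i] :
    IsPullback fst snd (f ≫ i) (g ≫ i) :=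
  ⟨⟨by simp only [← Category.assoc, h.w]⟩, ⟨PullbackCone.IsLimit.mk _
    (fun s ↦ h.lift s.fst s.snd (by simpa [cancel_mono, ← Category.assoc] using s.condition))
    (by simp) (by simp) (fun s m h1 h2 ↦ h.hom_ext (by simpa using h1) (by simpa using h2))⟩⟩

/-- A morphism from the spectrum of a field that is a preimmersion factors through an integral
closed subscheme as a flat preimmersion. -/
theorem exists_flat_isPreimmersion_integral {K : Type u} [Field K] {X : Scheme.{u}}
    [IsLocallyNoetherian X] (g : Spec (.of K) ⟶ X) [IsPreimmersion g] :
    ∃ (Z : Scheme.{u}) (i : Z ⟶ X) (j : Spec (.of K) ⟶ Z), IsClosedImmersion i ∧ IsIntegral Z ∧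
      Flat j ∧ IsPreimmersion j ∧ j ≫ i = g ∧
      ∀ U : Z.Opens, (U : Set Z).Nonempty → Set.range j ⊆ U := by
  have hj : IsPreimmersion (g.toImage ≫ g.imageι) := by simpa
  have : IsPreimmersion g.toImage := .of_comp _ g.imageι
  have hdense : DenseRange g.toImage := g.toImage.denseRange
  have hred : IsReduced g.image := by
    have (U : X.affineOpens) : IsReduced (g.ker.subschemeCover.openCover.X U) := by
      have : _root_.IsReduced (Γ(X, U) ⧸ g.ker.ideal U) := by
        rw [← Ideal.isRadical_iff_quotient_reduced, Scheme.Hom.ker_apply]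
        rintro x ⟨n, hn⟩
        rw [RingHom.mem_ker, map_pow] at hn
        exact IsReduced.eq_zero _ ⟨n, hn⟩
      exact inferInstanceAs (IsReduced (Spec (.of (Γ(X, U) ⧸ g.ker.ideal U))))
    exact @AlgebraicGeometry.IsReduced.of_openCover _ g.ker.subschemeCover.openCover this
  have hgen : ∀ z, IsGenericPoint (g.toImage z) Set.univ := by
    intro z
    have : Set.range g.toImage = {g.toImage z} := by
      ext y
      constructor
      · rintro ⟨w, rfl⟩
        rw [Subsingleton.elim (α := PrimeSpectrum K) w z]; rfl
      · rintro rfl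
        exact ⟨z, rfl⟩
    rw [DenseRange, dense_iff_closure_eq, this] at hdense
    exact hdense
  have hirr : IrreducibleSpace g.image := by
    have h := (hgen (closedPoint K)).isIrreducible
    have := h.isPreirreducible
    exact { isPreirreducible_univ := this, toNonempty := h.nonempty.to_type }
  have hint : IsIntegral g.image := isIntegral_of_irreducibleSpace_of_isReduced _
  refine ⟨g.image, g.imageι, g.toImage, inferInstance, inferInstance, ?_, inferInstance,
    g.toImage_imageι, ?_⟩
  · refine Flat.of_stalkMap _ fun z ↦ .of_isField ?_ _
    rw [(hgen z).eq (genericPoint_spec _)]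
    exact Field.toIsField g.image.functionField
  · rintro U hU _ ⟨z, rfl⟩
    exact ((hgen z).mem_open_set_iff U.2).mpr (by simpa using hU)

theorem flat_of_flat_comp_of_isOpenImmersion {X Y Z : Scheme.{u}} (f : X ⟶ Y) (g : Y ⟶ Z)
    [IsOpenImmersion g] [h : Flat (f ≫ g)] : Flat f := by
  let P : MorphismProperty Scheme.{u} := @Flat
  have : P.IsStableUnderBaseChange := Flat.isStableUnderBaseChange
  exact P.of_postcomp (W' := @IsOpenImmersion) f g ‹_› h

theorem exists_lift_of_isIso_restrict {S Y Z : Scheme.{u}} (f : Y ⟶ Z) (U : Z.Opens)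
    [IsIso (f ∣_ U)] (j : S ⟶ Z) [Flat j] [IsPreimmersion j] (hj : Set.range j ⊆ U) :
    ∃ q : S ⟶ Y, Flat q ∧ IsPreimmersion q ∧ q ≫ f = j := by
  let l := IsOpenImmersion.lift U.ι j (by simpa using hj)
  have hl : l ≫ U.ι = j := IsOpenImmersion.lift_fac _ _ _
  have : IsPreimmersion (l ≫ U.ι) := hl ▸ ‹_›
  have : IsPreimmersion l := .of_comp _ U.ι
  have : Flat (l ≫ U.ι) := hl ▸ ‹_›
  have : Flat l := flat_of_flat_comp_of_isOpenImmersion l U.ι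
  refine ⟨l ≫ inv (f ∣_ U) ≫ (f ⁻¹ᵁ U).ι, inferInstance, inferInstance, ?_⟩
  simp only [Category.assoc, ← morphismRestrict_ι, IsIso.inv_hom_id_assoc, hl]
end

section
open Limits IsLocalRing

section
variable (R : Type u) [CommRing R] [IsLocalRing R]

instance flat_completionSpecMap [IsNoetherianRing R] : Flat (completionSpecMap R) :=
  Flat.SpecMap_iff.mpr (AdicCompletion.flat_of_isNoetherian (maximalIdeal R))

theorem eq_closedPoint_of_completionSpecMap_eq [IsNoetherianRing R]
    (q : PrimeSpectrum (AdicCompletion (maximalIdeal R) R))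
    (hq : completionSpecMap R q = closedPoint R) :
    q = closedPoint (AdicCompletion (maximalIdeal R) R) := by
  refine PrimeSpectrum.ext ((le_maximalIdeal q.isPrime.ne_top).antisymm ?_)
  rw [AdicCompletion.maximalIdeal_eq_map, Ideal.map_le_iff_le_comap]
  exact congr(($hq).asIdeal).ge

theorem completionSpecMap_closedPoint [IsNoetherianRing R] :
    completionSpecMap R (closedPoint (AdicCompletion (maximalIdeal R) R)) = closedPoint R :=
  comap_closedPoint (algebraMap R (AdicCompletion (maximalIdeal R) R))

/-- The closed point of the spectrum of the completion of a local ring, as a closed subscheme. -/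
noncomputable def completionClosedPointι [IsNoetherianRing R] :
    Spec (.of (ResidueField (AdicCompletion (maximalIdeal R) R))) ⟶
      Spec (.of (AdicCompletion (maximalIdeal R) R)) :=
  Spec.map (CommRingCat.ofHom (residue _))

instance isPreimmersion_completionClosedPointι_comp [IsNoetherianRing R] :
    IsPreimmersion (completionClosedPointι R ≫ completionSpecMap R) := by
  rw [completionClosedPointι, completionSpecMap, ← Spec.map_comp, ← CommRingCat.ofHom_comp]
  have := IsClosedImmersion.spec_of_surjective (CommRingCat.ofHom
    ((residue (AdicCompletion (maximalIdeal R) R)).comp (algebraMap R _))) (by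
      intro y
      obtain ⟨z, rfl⟩ := (AdicCompletion.residueField_map_bijective R).2 y
      obtain ⟨r, rfl⟩ := residue_surjective z
      exact ⟨r, rfl⟩)
  infer_instance

theorem closedPoint_mem_range_completionClosedPointι [IsNoetherianRing R] :
    closedPoint (AdicCompletion (maximalIdeal R) R) ∈ Set.range (completionClosedPointι R) :=
  ⟨closedPoint _, comap_closedPoint (residue (AdicCompletion (maximalIdeal R) R))⟩
end

section
variable {X Y : Scheme.{u}} [IsLocallyNoetherian X] (h : Y ⟶ X) (x : X)

/-- The canonical morphism from the spectrum of the completion of the local ring at a point. -/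
noncomputable abbrev fromSpecCompletion :
    Spec (.of (AdicCompletion (maximalIdeal (X.presheaf.stalk x)) (X.presheaf.stalk x))) ⟶ X :=
  completionSpecMap (X.presheaf.stalk x) ≫ X.fromSpecStalk x

theorem eq_of_pullback_fst_eq
    {w w' : ↥(pullback h (fromSpecCompletion x))}
    (hw : pullback.snd h (fromSpecCompletion x) w = closedPoint _)
    (hww' : pullback.fst h (fromSpecCompletion x) w' = pullback.fst h (fromSpecCompletion x) w) :
    w' = w := by
  let R := X.presheaf.stalk x
  have hcond (v : ↥(pullback h (fromSpecCompletion x))) :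
      h (pullback.fst h (fromSpecCompletion x) v) =
        X.fromSpecStalk x (completionSpecMap R (pullback.snd h (fromSpecCompletion x) v)) :=
    congr($(pullback.condition (f := h) (g := fromSpecCompletion x)) v)
  have hw' : pullback.snd h (fromSpecCompletion x) w' = closedPoint _ := by
    refine eq_closedPoint_of_completionSpecMap_eq R _ ?_
    refine Eq.trans ?_ (completionSpecMap_closedPoint R)
    rw [← hw]
    apply (X.fromSpecStalk x).injective
    rw [← hcond, ← hcond, hww']
  let ι := completionClosedPointι R
  have hrange (v : ↥(pullback h (fromSpecCompletion x)))
      (hv : pullback.snd h (fromSpecCompletion x) v = closedPoint _) :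
      v ∈ Set.range (pullback.fst (pullback.snd h (fromSpecCompletion x)) ι) := by
    rw [Scheme.Pullback.range_fst, Set.mem_preimage, hv]
    exact closedPoint_mem_range_completionClosedPointι R
  obtain ⟨v, rfl⟩ := hrange w hw
  obtain ⟨v', rfl⟩ := hrange w' hw'
  have hpb := (IsPullback.of_hasPullback (pullback.snd h (fromSpecCompletion x)) ι).flip.paste_vert
    (IsPullback.of_hasPullback h (fromSpecCompletion x)).flip
  have : IsPreimmersion (ι ≫ fromSpecCompletion x) := by
    rw [← Category.assoc]
    infer_instance
  have : IsPreimmersion (pullback.fst (pullback.snd h (fromSpecCompletion x)) ι ≫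
    pullback.fst h (fromSpecCompletion x)) :=
    MorphismProperty.of_isPullback hpb this
  congr 1
  exact (pullback.fst (pullback.snd h (fromSpecCompletion x)) ι ≫
    pullback.fst h (fromSpecCompletion x)).injective hww'

theorem IsCohenMacaulayScheme.pullback_fromSpecCompletion (hY : IsCohenMacaulayScheme Y)
    [IsProper h] : IsCohenMacaulayScheme (pullback h (fromSpecCompletion x)) where
  isLocallyNoetherian := inferInstance
  depth_eq_dim w := by
    have := hY.isLocallyNoetherian
    obtain ⟨w₀, hspec, hw₀⟩ : ∃ w₀, w ⤳ w₀ ∧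
        pullback.snd h (fromSpecCompletion x) w₀ = closedPoint _ := by
      have hcl := (pullback.snd h (fromSpecCompletion x)).isClosedMap _
        (isClosed_closure (s := {w}))
      have hmem := (specializes_closedPoint (pullback.snd h (fromSpecCompletion x) w)).mem_closed
        hcl ⟨w, subset_closure rfl, rfl⟩
      obtain ⟨w₀, hw₀, heq⟩ := hmem
      exact ⟨w₀, specializes_iff_mem_closure.mpr hw₀, heq⟩
    exact localDepth_stalk_eq_of_specializes hspec
      (localDepth_stalk_eq_of_flat (pullback.fst h (fromSpecCompletion x)) w₀
        (fun _ ↦ eq_of_pullback_fst_eq h x hw₀) (hY.depth_eq_dim _))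

theorem IsCohenMacaulayScheme.of_isPullback_fromSpecCompletion (hY : IsCohenMacaulayScheme Y)
    [IsProper h] {F S : Scheme.{u}} [IsLocallyNoetherian F] (q : S ⟶ Y) [Flat q] [IsPreimmersion q]
    {fst : F ⟶ _} {snd : F ⟶ S} (hF : IsPullback fst snd (fromSpecCompletion x) (q ≫ h)) :
    IsCohenMacaulayScheme F := by
  let l : F ⟶ pullback h (fromSpecCompletion x) :=
    pullback.lift (snd ≫ q) fst (by rw [Category.assoc, hF.w])
  have hl : IsPullback l snd (pullback.fst h (fromSpecCompletion x)) q :=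
    IsPullback.of_right (by rwa [show l ≫ pullback.snd h _ = fst from pullback.lift_snd _ _ _])
      (pullback.lift_fst _ _ _)
      (IsPullback.of_hasPullback h (fromSpecCompletion x)).flip
  have : Flat l := MorphismProperty.of_isPullback hl.flip ‹Flat q›
  have : IsPreimmersion l := MorphismProperty.of_isPullback hl.flip ‹IsPreimmersion q›
  exact (hY.pullback_fromSpecCompletion h x).of_flat_of_injective l l.injective

open TensorProduct in
theorem isLocallyNoetherian_fiber_Spec {R S : Type u} [CommRing R] [CommRing S] [Algebra R S]
    [IsNoetherianRing S] (p : Spec (.of R)) :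
    IsLocallyNoetherian ((Spec.map (CommRingCat.ofHom (algebraMap R S))).fiber p) := by
  have : p.asIdeal.IsPrime := PrimeSpectrum.isPrime p
  have : IsNoetherianRing (p.asIdeal.Fiber S) :=
    have : IsNoetherianRing (S ⊗[R] p.asIdeal.ResidueField) :=
      Algebra.EssFiniteType.isNoetherianRing S _
    isNoetherianRing_of_ringEquiv _
      (Algebra.TensorProduct.comm R S p.asIdeal.ResidueField).toRingEquiv
  let e : (Spec.map (CommRingCat.ofHom (algebraMap R S))).fiber p ≅
      Spec (.of (p.asIdeal.Fiber S)) :=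
    Arrow.leftFunc.mapIso (Spec.fiberToSpecResidueFieldIso R S p)
  exact isLocallyNoetherian_of_isOpenImmersion e.hom

theorem formalFiber_cohenMacaulay
    (H : ∀ (Z : Scheme.{u}) (i : Z ⟶ X) [IsClosedImmersion i] [IsIntegral Z],
      ∃ (Y : Scheme.{u}) (f : Y ⟶ Z), IsCohenMacaulayScheme Y ∧ IsProper f ∧
        ∃ U : Z.Opens, (U : Set Z).Nonempty ∧ IsIso (f ∣_ U))
    (p : Spec (CommRingCat.of (X.presheaf.stalk x))) :
    IsCohenMacaulayScheme ((completionSpecMap (X.presheaf.stalk x)).fiber p) := by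
  let g : Spec (.of ((Spec (X.presheaf.stalk x)).residueField p)) ⟶ X :=
    (Spec (X.presheaf.stalk x)).fromSpecResidueField p ≫ X.fromSpecStalk x
  have : IsPreimmersion g := IsPreimmersion.comp _ _
  obtain ⟨Z, i, j, _, _, _, _, hji, hjU⟩ := exists_flat_isPreimmersion_integral g
  obtain ⟨Y, f, hY, _, U, hU, _⟩ := H Z i
  obtain ⟨q, _, _, hq⟩ := exists_lift_of_isIso_restrict f U j (hjU U hU)
  have hfib := IsPullback.comp_mono (IsPullback.of_hasPullback
    (completionSpecMap (X.presheaf.stalk x))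
    ((Spec (X.presheaf.stalk x)).fromSpecResidueField p)) (X.fromSpecStalk x)
  have hqg : q ≫ f ≫ i = g := by rw [← Category.assoc, hq, hji]
  have : IsLocallyNoetherian ((completionSpecMap (X.presheaf.stalk x)).fiber p) :=
    isLocallyNoetherian_fiber_Spec p
  refine hY.of_isPullback_fromSpecCompletion (f ≫ i) x q
    (F := (completionSpecMap (X.presheaf.stalk x)).fiber p) (fst := pullback.fst _ _)
    (snd := pullback.snd _ _) ?_
  rw [hqg]
  exact hfib
end

end

theorem mainTheorem5 (X : Scheme.{u}) [IsLocallyNoetherian X]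
    (h : ∀ (Z : Scheme.{u}) (i : Z ⟶ X) [IsClosedImmersion i] [IsIntegral Z],
      ∃ (Y : Scheme.{u}) (f : Y ⟶ Z), IsCohenMacaulayScheme Y ∧ IsProper f ∧
        ∃ U : Z.Opens, (U : Set Z).Nonempty ∧ IsIso (f ∣_ U)) :
    IsCMQuasiExcellent X where
  isLocallyNoetherian := inferInstance
  formalFiber_cohenMacaulay x p := formalFiber_cohenMacaulay x h p
  exists_open_cohenMacaulay Z i _ _ := by
    obtain ⟨Y, f, hY, _, U, hU, _⟩ := h Z i
    have : IsLocallyNoetherian Z := LocallyOfFiniteType.isLocallyNoetherian i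
    exact ⟨U, hU, hY.opens_of_isIso_restrict f U⟩
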